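/- **Generalization bound for federated learning.** Let $\mathcal X$ (inputs) and $\mathcal Z$ (features) be measurable spaces, and let $\mathcal R:\mathcal X\to\mathcal Z$ be a fixed measurable feature map shared by $K\ge 1$ users. Let $c^*:\mathcal X\to\{0,1\}$ be a measurable labeling function, let $\mathcal D_1,\dots,\mathcal D_K$ and $\mathcal D$ be probability distributions on $\mathcal X$, and let $\mathcal T_k=\langle\mathcal D_k,c^*\rangle$ be the local domains and $\mathcal T=\langle\mathcal D,c^*\rangle$ the global domain. For $g:\mathcal Z\to[0,1]$ and a domain $\langle\mathcal D',c^*\rangle$ the risk is $\mathcal L_{\langle\mathcal D',c^*\rangle}(g)=\mathbb E_{x\sim\mathcal D'}|g(\mathcal R(x))-c^*(x)|$. Let $\mathcal H$ be a class of measurable hypotheses $\mathcal Z\to\{0,1\}$ of finite VC dimension $d$. Let $m\ge1$ with $d\le 2m$. On a standard Borel probability space, let user $k$ hold samples $x_{k,1},\dots,x_{k,m}$ that are i.i.d. with law $\mathcal D_k$ (nothing is assumed about dependence between different users), and let $h_k\in\mathcal H$ be the hypothesis learned by user $k$: a random element of $\mathcal H$, which may depend in any (jointly measurable) way on all data and on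 further randomness. Put $\hat{\mathcal L}_{\mathcal T_k}(h_k)=\frac1m\sum_{i=1}^m|h_k(\mathcal R(x_{k,i}))-c^*(x_{k,i})|$ and let $h=\frac1K\sum_{k=1}^K h_k:\mathcal Z\to[0,1]$ be the ensemble. Let $\tilde{\mathcal D}_k$, $\tilde{\mathcal D}$ be the images of $\mathcal D_k$, $\mathcal D$ under $\mathcal R$, and let $$d_{\mathcal H\triangle\mathcal H}(\tilde{\mathcal D}_k,\tilde{\mathcal D})=2\sup_{f,f'\in\mathcal H}\bigl|\Pr_{z\sim\tilde{\mathcal D}_k}[f(z)\ne f'(z)]-\Pr_{z\sim\tilde{\mathcal D}}[f(z)\neq f'(z)]\bigr|,\qquad \lambda_k=\inf_{f\in\mathcal H}\bigl(\mathcal L_{\mathcal T_k}(f)+\mathcal L_{\mathcal T}(f)\bigr).$$ Then for every $\delta>0$, with probability at least $1-\delta$, $$\mathcal L_{\mathcal T}(h)\le\frac1K\sum_{k=1}^K\hat{\mathcal L}_{\mathcal T_k}(h_k)+\frac1K\sum_{k=1}^K\bigl(d_{\mathcal H\triangle\mathcal H}(\tilde{\mathcal D}_k,\tilde{\mathcal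 D})+\lambda_k\bigr)+\sqrt{\frac4m\Bigl(d\log\frac{2em}{d}+\log\frac{4K}{\delta}\Bigr)},$$ where $d\log\frac{2em}{d}$ is read as $0$ when $d=0$. -/

import Mathlib

open MeasureTheory ProbabilityTheory

namespace FedLearn

/-- A domain (task): a data distribution on the input space and a ground-truth binary labeling. -/
structure Domain (X : Type*) [MeasurableSpace X] where
  dist : Measure X
  label : X → Bool

/-- The numerical value in `{0, 1}` of a binary label. -/
noncomputable def val (b : Bool) : ℝ := if b then 1 else 0

/-- The loss `l(ŷ, y) = |ŷ - y|` of a (possibly soft) prediction `ŷ` against a binary label. -/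
noncomputable def loss (yhat : ℝ) (y : Bool) : ℝ := |yhat - val y|

/-- The risk on the domain `T` of the predictor `g`, which acts on features `R x`. -/
noncomputable def risk {X Z : Type*} [MeasurableSpace X] (R : X → Z) (T : Domain X)
    (g : Z → ℝ) : ℝ :=
  ∫ x, loss (g (R x)) (T.label x) ∂T.dist

/-- The empirical risk of `g` on the sample `x₁, …, x_m`, labeled by the domain's labeling. -/
noncomputable def empRisk {X Z : Type*} [MeasurableSpace X] (R : X → Z) (T : Domain X)
    {m : ℕ} (x : Fin m → X) (g : Z → ℝ) : ℝ :=
  (1 / (m : ℝ)) * ∑ i, loss (g (R (x i))) (T.label (x i))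

/-- A binary hypothesis seen as a real-valued predictor. -/
noncomputable def toPredictor {Z : Type*} (h : Z → Bool) : Z → ℝ := fun z => val (h z)

/-- The ensemble `(1/K) ∑ₖ hₖ` of binary hypotheses; it takes values in `[0, 1]`. -/
noncomputable def ensemble {Z : Type*} {K : ℕ} (h : Fin K → Z → Bool) : Z → ℝ :=
  fun z => (1 / (K : ℝ)) * ∑ k, toPredictor (h k) z

/-- The induced image on the feature space of a distribution under the feature map `R`. -/
noncomputable def inducedImage {X Z : Type*} [MeasurableSpace X] [MeasurableSpace Z]
    (R : X → Z) (D : Measure X) : Measure Z :=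
  D.map R

/-- The divergence `2 sup |P(A) - Q(A)|`, over the events `A = {z | g z = 1}` with `g ∈ G`. -/
noncomputable def hDivergence {Z : Type*} [MeasurableSpace Z] (G : Set (Z → Bool))
    (P Q : Measure Z) : ℝ :=
  2 * sSup {r : ℝ | ∃ g ∈ G, r = |P.real {z | g z = true} - Q.real {z | g z = true}|}

/-- The symmetric difference hypothesis space `{h ⊕ h' | h, h' ∈ H}`. -/
def symmDiffClass {Z : Type*} (H : Set (Z → Bool)) : Set (Z → Bool) :=
  {g | ∃ h ∈ H, ∃ h' ∈ H, g = fun z => xor (h z) (h' z)}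

/-- The oracle term: the infimum over `h ∈ H` of the sum of the risks of `h` on two domains. -/
noncomputable def oracle {X Z : Type*} [MeasurableSpace X] (R : X → Z) (H : Set (Z → Bool))
    (T T' : Domain X) : ℝ :=
  sInf {r : ℝ | ∃ h ∈ H, r = risk R T (toPredictor h) + risk R T' (toPredictor h)}

/-- `H` shatters the finite set `s`: each labeling of `s` is realized by a member of `H`. -/
def Shatters {Z : Type*} (H : Set (Z → Bool)) (s : Finset Z) : Prop :=
  ∀ f : Z → Bool, ∃ h ∈ H, ∀ z ∈ s, h z = f z

/-- The Vapnik-Chervonenkis dimension of a class of binary hypotheses. -/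
noncomputable def vcDim {Z : Type*} (H : Set (Z → Bool)) : ℕ∞ :=
  ⨆ (s : Finset Z) (_ : Shatters H s), (s.card : ℕ∞)

end FedLearn

namespace FedLearn

/-! The loss is convex in the prediction, so the risk of the ensemble is at most the average risk of
its members (`risk_ensemble_le`), and each user can be treated alone. Passing from the local to the
global domain is a triangle inequality through a competitor f in `H`: the divergence controls how
much the disagreement of h_k with f changes between the domains, and the risks of f make up the
oracle term (`risk_le_risk_add_hDivergence_add_oracle`).

There remains the gap between local and empirical risk for a hypothesis chosen after seeing the data
(`measure_deviation_le`). Chebyshev replaces the risk by the error on an independent ghost sample;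
random swaps between the two samples turn the difference of errors into a Rademacher sum;
Sauer-Shelah leaves few error patterns, and Hoeffding's inequality bounds each. A supremum over `H`
need not be measurable, so the argument follows the selected hypothesis, through its conditional law
given the sample.

Each user is allowed failure probability δ/K. The union bound needs no independence between users.
-/

theorem val_nonneg (b : Bool) : 0 ≤ val b := by cases b <;> simp [val]

theorem val_le_one (b : Bool) : val b ≤ 1 := by cases b <;> simp [val]

/-! ### Hoeffding's inequality for Rademacher sums -/

/-- The sign attached to a Boolean. -/
noncomputable def boolSign (b : Bool) : ℝ := if b then 1 else -1

/-- The sum over sign vectors factors into a product of terms 2 cosh(l a_i), and cosh x ≤ exp(x²/2).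
-/
theorem sum_exp_boolSign_le {m : ℕ} (a : Fin m → ℝ) (ha : ∀ i, |a i| ≤ 1) (l : ℝ) :
    ∑ σ : Fin m → Bool, Real.exp (l * ∑ i, boolSign (σ i) * a i)
      ≤ 2 ^ m * Real.exp (m * (l ^ 2 / 2)) := by
  have h1 : ∑ σ : Fin m → Bool, Real.exp (l * ∑ i, boolSign (σ i) * a i)
      = ∏ i, ∑ b : Bool, Real.exp (l * (boolSign b * a i)) := by
    rw [Finset.prod_univ_sum, Fintype.piFinset_univ]
    refine Finset.sum_congr rfl fun σ _ => ?_
    rw [Finset.mul_sum, Real.exp_sum]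
  have h2 : ∀ i, ∑ b : Bool, Real.exp (l * (boolSign b * a i)) ≤ 2 * Real.exp (l ^ 2 / 2) := by
    intro i
    have e : ∑ b : Bool, Real.exp (l * (boolSign b * a i)) = 2 * Real.cosh (l * a i) := by
      rw [Fintype.sum_bool, Real.cosh_eq]
      simp only [boolSign, if_true, Bool.false_eq_true, if_false]
      ring_nf
    rw [e]
    have hsq : (l * a i) ^ 2 ≤ l ^ 2 := by
      rw [mul_pow]
      have : a i ^ 2 ≤ 1 := (sq_le_one_iff_abs_le_one _).2 (ha i)
      nlinarith [sq_nonneg l]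
    have := Real.cosh_le_exp_half_sq (l * a i)
    have h3 : Real.exp ((l * a i) ^ 2 / 2) ≤ Real.exp (l ^ 2 / 2) :=
      Real.exp_le_exp.2 (by linarith)
    linarith
  rw [h1]
  calc ∏ i, ∑ b : Bool, Real.exp (l * (boolSign b * a i))
      ≤ ∏ _i : Fin m, 2 * Real.exp (l ^ 2 / 2) :=
        Finset.prod_le_prod (fun i _ => Finset.sum_nonneg fun _ _ => (Real.exp_pos _).le)
          fun i _ => h2 i
    _ = _ := by
        rw [Finset.prod_const, Finset.card_univ, Fintype.card_fin, mul_pow, ← Real.exp_nat_mul]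

/-- Hoeffding's inequality for a Rademacher sum with coefficients in `[-1, 1]`. -/
theorem card_boolSign_sum_ge_le {m : ℕ} (hm : 0 < m) (a : Fin m → ℝ) (ha : ∀ i, |a i| ≤ 1)
    {u : ℝ} (hu : 0 ≤ u) :
    ((Finset.univ.filter fun σ : Fin m → Bool => u ≤ ∑ i, boolSign (σ i) * a i).card : ℝ)
      ≤ 2 ^ m * Real.exp (-(u ^ 2 / (2 * m))) := by
  have hm' : (0 : ℝ) < m := by exact_mod_cast hm
  -- This `l` minimizes the Chernoff exponent m l²/2 - l u.
  set l : ℝ := u / m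
  have hl : 0 ≤ l := by positivity
  have h := sum_exp_boolSign_le a ha l
  have h1 : ((Finset.univ.filter fun σ : Fin m → Bool =>
        u ≤ ∑ i, boolSign (σ i) * a i).card : ℝ) * Real.exp (l * u)
      ≤ ∑ σ : Fin m → Bool, Real.exp (l * ∑ i, boolSign (σ i) * a i) := by
    rw [← nsmul_eq_mul]
    refine (Finset.card_nsmul_le_sum _
      (fun σ : Fin m → Bool => Real.exp (l * ∑ i, boolSign (σ i) * a i)) _ fun σ hσ => ?_).trans
      (Finset.sum_le_sum_of_subset_of_nonneg (Finset.filter_subset _ _)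
        fun _ _ _ => (Real.exp_pos _).le)
    exact Real.exp_le_exp.2 (mul_le_mul_of_nonneg_left (Finset.mem_filter.1 hσ).2 hl)
  have e : Real.exp (m * (l ^ 2 / 2)) = Real.exp (-(u ^ 2 / (2 * m))) * Real.exp (l * u) := by
    rw [← Real.exp_add]
    congr 1
    simp only [l]
    field_simp
    ring
  rw [e, ← mul_assoc] at h
  exact le_of_mul_le_mul_right (h1.trans h) (Real.exp_pos _)

/-! ### Growth function and VC dimension -/

open Classical in
/-- The labelings of the points `y` that the class `F` realizes. -/
noncomputable def traces {X ι : Type*} [Fintype ι] (F : Set (X → Bool)) (y : ι → X) :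
    Finset (ι → Bool) :=
  Finset.univ.filter fun p => ∃ f ∈ F, p = fun j => f (y j)

theorem mem_traces {X ι : Type*} [Fintype ι] {F : Set (X → Bool)} {y : ι → X} {p : ι → Bool} :
    p ∈ traces F y ↔ ∃ f ∈ F, p = fun j => f (y j) := by
  classical simp [traces]

/-- The Sauer-Shelah lemma. -/
theorem card_traces_le {Z ι : Type*} [Fintype ι] {H : Set (Z → Bool)} {d : ℕ}
    (hd : vcDim H ≤ d) (y : ι → Z) :
    (traces H y).card ≤ ∑ k ∈ Finset.Iic d, (Fintype.card ι).choose k := by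
  classical
  let toSet : (ι → Bool) → Finset ι := fun p => Finset.univ.filter fun j => p j = true
  have hinj : Function.Injective toSet := by
    intro p q hpq
    funext j
    have := congrArg (j ∈ ·) hpq
    simp only [toSet, Finset.mem_filter, Finset.mem_univ, true_and, eq_iff_iff] at this
    exact Bool.eq_iff_iff.2 this
  set A : Finset (Finset ι) := (traces H y).image toSet
  have hA : A.card = (traces H y).card := Finset.card_image_of_injective _ hinj
  have key : ∀ s : Finset ι, A.Shatters s → s.card ≤ d := by
    intro s hs
    have hmem : ∀ t ⊆ s, ∃ f ∈ H, ∀ j ∈ s, (f (y j) = true ↔ j ∈ t) := by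
      intro t ht
      obtain ⟨u, hu, hut⟩ := hs ht
      obtain ⟨p, hp, rfl⟩ := Finset.mem_image.1 hu
      obtain ⟨f, hf, rfl⟩ := mem_traces.1 hp
      refine ⟨f, hf, fun j hj => ?_⟩
      rw [← hut]
      simp [toSet, hj]
    -- The family `y` may repeat points, but a pattern cutting out {i} separates i from the rest of
    -- `s`; so the image in `Z` keeps the cardinality of `s`.
    have hyinj : Set.InjOn y s := by
      intro i hi j hj hij
      obtain ⟨f, -, hf⟩ := hmem {i} (by simpa using hi)
      have h1 := (hf i hi).2 (by simp)
      rw [hij] at h1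
      have := (hf j hj).1 h1
      exact (Finset.mem_singleton.1 this).symm
    have hsh : Shatters H (s.image y) := by
      intro g
      obtain ⟨f, hf, hfs⟩ := hmem (s.filter fun j => g (y j) = true) (Finset.filter_subset _ _)
      refine ⟨f, hf, fun z hz => ?_⟩
      obtain ⟨j, hj, rfl⟩ := Finset.mem_image.1 hz
      have := hfs j hj
      simp only [Finset.mem_filter, hj, true_and] at this
      exact Bool.eq_iff_iff.2 this
    have h1 : ((s.image y).card : ℕ∞) ≤ vcDim H :=
      le_iSup₂ (f := fun (s : Finset Z) (_ : Shatters H s) => (s.card : ℕ∞)) _ hsh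
    rw [Finset.card_image_of_injOn hyinj] at h1
    exact_mod_cast h1.trans hd
  have hvc : A.vcDim ≤ d := Finset.sup_le fun s hs => key s (Finset.mem_shatterer.1 hs)
  rw [← hA]
  refine (Finset.card_le_card_shatterer A).trans (Finset.card_shatterer_le_sum_vcDim.trans ?_)
  exact Finset.sum_le_sum_of_subset (Finset.Iic_subset_Iic.2 hvc)

/-- Weighting the k-th term by (n/d)^(d-k) ≥ 1 and extending the sum to all k ≤ n gives (n/d)^d (1 +
d/n)^n by the binomial theorem, at most (en/d)^d. -/
theorem sum_choose_le_exp {n d : ℕ} (hd : 0 < d) (hdn : d ≤ n) :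
    ((∑ k ∈ Finset.Iic d, n.choose k : ℕ) : ℝ) ≤ Real.exp (d * Real.log (Real.exp 1 * n / d)) := by
  have hd' : (0 : ℝ) < d := by exact_mod_cast hd
  have hn' : (0 : ℝ) < n := by exact_mod_cast hd.trans_le hdn
  have hq : (1 : ℝ) ≤ n / d := by rw [le_div_iff₀ hd']; simpa using (by exact_mod_cast hdn : (d : ℝ) ≤ n)
  have hr : (Real.exp (d * Real.log (Real.exp 1 * n / d))) = (n / d : ℝ) ^ d * Real.exp d := by
    rw [mul_comm, Real.exp_mul, Real.exp_log (by positivity), Real.rpow_natCast, mul_div_assoc,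
      mul_pow, ← Real.exp_nat_mul]
    ring_nf
  rw [hr]
  push_cast
  calc ∑ k ∈ Finset.Iic d, (n.choose k : ℝ)
      ≤ ∑ k ∈ Finset.Iic d, (n / d : ℝ) ^ d * ((d / n : ℝ) ^ k * n.choose k) := by
        refine Finset.sum_le_sum fun k hk => ?_
        have hkd := Finset.mem_Iic.1 hk
        have e : (n / d : ℝ) ^ d * (d / n : ℝ) ^ k = (n / d : ℝ) ^ (d - k) := by
          rw [← inv_div (n : ℝ) d, inv_pow, pow_sub₀ _ (by positivity) hkd]
        rw [← mul_assoc, e]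
        exact le_mul_of_one_le_left (by positivity) (one_le_pow₀ hq)
    _ = (n / d : ℝ) ^ d * ∑ k ∈ Finset.Iic d, (d / n : ℝ) ^ k * n.choose k := by
        rw [Finset.mul_sum]
    _ ≤ (n / d : ℝ) ^ d * ∑ k ∈ Finset.range (n + 1), (d / n : ℝ) ^ k * n.choose k := by
        refine mul_le_mul_of_nonneg_left ?_ (by positivity)
        refine Finset.sum_le_sum_of_subset_of_nonneg (fun k hk => ?_) fun _ _ _ => by positivity
        rw [Finset.mem_range]
        have := Finset.mem_Iic.1 hk
        omega
    _ = (n / d : ℝ) ^ d * (d / n + 1 : ℝ) ^ n := by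
        rw [add_pow]
        simp
    _ ≤ (n / d : ℝ) ^ d * Real.exp d := by
        refine mul_le_mul_of_nonneg_left ?_ (by positivity)
        calc (d / n + 1 : ℝ) ^ n ≤ Real.exp (d / n) ^ n :=
              pow_le_pow_left₀ (by positivity) (Real.add_one_le_exp _) _
          _ = Real.exp d := by
              rw [← Real.exp_nat_mul, mul_div_cancel₀ _ hn'.ne']

theorem card_traces_le_exp {Z ι : Type*} [Fintype ι] {H : Set (Z → Bool)} {d : ℕ}
    (hd : vcDim H ≤ d) (y : ι → Z) (hdn : d ≤ Fintype.card ι) :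
    ((traces H y).card : ℝ) ≤
      Real.exp (d * Real.log (Real.exp 1 * Fintype.card ι / d)) := by
  have h := card_traces_le hd y
  -- For d = 0 the exponent is 0 whatever the logarithm of the division by zero is, and the Sauer
  -- sum is its single term 1.
  rcases Nat.eq_zero_or_pos d with rfl | hd0
  · have : ((traces H y).card : ℝ) ≤ 1 := by
      have h0 : Finset.Iic 0 = ({0} : Finset ℕ) := by ext; simp
      rw [h0] at h
      exact_mod_cast (by simpa using h)
    simpa using this
  · exact le_trans (by exact_mod_cast h) (sum_choose_le_exp hd0 hdn)

/-! ### Symmetrization and the uniform deviation inequality -/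

/-- Exchange the two components of `z i` at the indices where `σ i` is false. -/
def swapAt {X : Type*} {m : ℕ} (σ : Fin m → Bool) (z : Fin m → X × X) : Fin m → X × X :=
  fun i => if σ i then z i else (z i).swap

/-- The points of a double sample as one family. -/
def points {X : Type*} {m : ℕ} (z : Fin m → X × X) : Fin m × Bool → X :=
  fun j => if j.2 then (z j.1).2 else (z j.1).1

-- With the double sample fixed, a swap at i flips the sign of the i-th difference. Only the traces
-- of `F` matter, so a union bound over them and Hoeffding suffice.
open Classical in
theorem card_swapAt_deviation_le {X : Type*} {m : ℕ} (hm : 0 < m) {F : Set (X → Bool)} {N : ℝ}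
    (z : Fin m → X × X) (hN : ((traces F (points z)).card : ℝ) ≤ N) {u : ℝ} (hu : 0 ≤ u) :
    ((Finset.univ.filter fun σ : Fin m → Bool => ∃ f ∈ F,
        u ≤ ∑ i, (val (f (swapAt σ z i).2) - val (f (swapAt σ z i).1))).card : ℝ)
      ≤ N * (2 ^ m * Real.exp (-(u ^ 2 / (2 * m)))) := by
  set B : (Fin m × Bool → Bool) → Finset (Fin m → Bool) := fun p =>
    Finset.univ.filter fun σ => u ≤ ∑ i, boolSign (σ i) * (val (p (i, true)) - val (p (i, false)))
  have hB : ∀ p, ((B p).card : ℝ) ≤ 2 ^ m * Real.exp (-(u ^ 2 / (2 * m))) := fun p =>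
    card_boolSign_sum_ge_le hm _ (fun i => abs_sub_le_iff.2
      ⟨by linarith [val_nonneg (p (i, false)), val_le_one (p (i, true))],
        by linarith [val_nonneg (p (i, true)), val_le_one (p (i, false))]⟩) hu
  have hsub : (Finset.univ.filter fun σ : Fin m → Bool => ∃ f ∈ F,
      u ≤ ∑ i, (val (f (swapAt σ z i).2) - val (f (swapAt σ z i).1)))
      ⊆ (traces F (points z)).biUnion B := by
    intro σ hσ
    obtain ⟨-, f, hf, h⟩ := Finset.mem_filter.1 hσ
    refine Finset.mem_biUnion.2 ⟨_, mem_traces.2 ⟨f, hf, rfl⟩, Finset.mem_filter.2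
      ⟨Finset.mem_univ _, h.trans_eq (Finset.sum_congr rfl fun i _ => ?_)⟩⟩
    cases hσi : σ i <;> simp [swapAt, points, boolSign, hσi]
  calc _ ≤ (((traces F (points z)).biUnion B).card : ℝ) := by
        exact_mod_cast Finset.card_le_card hsub
    _ ≤ ∑ p ∈ traces F (points z), ((B p).card : ℝ) := by
        exact_mod_cast Finset.card_biUnion_le
    _ ≤ (traces F (points z)).card * (2 ^ m * Real.exp (-(u ^ 2 / (2 * m)))) := by
        rw [← nsmul_eq_mul]
        exact Finset.sum_le_card_nsmul _ _ _ fun p _ => hB p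
    _ ≤ _ := mul_le_mul_of_nonneg_right hN (by positivity)

theorem measurable_val : Measurable val := measurable_from_top

/-- With probability at least one half, the empirical error exceeds the error minus a Chebyshev
margin. -/
theorem half_le_measure_sum_val_ge {X : Type*} [MeasurableSpace X] (μ : Measure X)
    [IsProbabilityMeasure μ] {m : ℕ} (hm : 0 < m) {f : X → Bool} (hf : Measurable f) :
    (1 / 2 : ENNReal) ≤ Measure.pi (fun _ : Fin m => μ)
      {x | m * ∫ y, val (f y) ∂μ - √(m / 2) ≤ ∑ i, val (f (x i))} := by
  have hm' : (0 : ℝ) < m := by exact_mod_cast hm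
  set ν := Measure.pi (fun _ : Fin m => μ)
  have hv : Measurable fun y => val (f y) := measurable_val.comp hf
  have hL : MemLp (fun y => val (f y)) 2 μ :=
    MemLp.of_bound hv.aestronglyMeasurable 1 (Filter.Eventually.of_forall fun y => by
      rw [Real.norm_eq_abs, abs_of_nonneg (val_nonneg _)]; exact val_le_one _)
  set T : (Fin m → X) → ℝ := ∑ i, fun x => val (f (x i)) with hT
  have hTm : MemLp T 2 ν := memLp_finsetSum' _ fun i _ =>
    hL.comp_measurePreserving (measurePreserving_eval (fun _ : Fin m => μ) i)
  have hTapp : ∀ x, T x = ∑ i, val (f (x i)) := fun x => by simp [hT]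
  have hvar : Var[T; ν] ≤ m / 4 := by
    rw [hT, variance_sum_pi (μ := fun _ : Fin m => μ) (X := fun _ y => val (f y)) fun _ => hL]
    -- A [0, 1]-valued variable has variance at most 1/4, so Chebyshev with margin √(m/2) fails with
    -- probability at most (m/4)/(m/2) = 1/2.
    have : Var[fun y => val (f y); μ] ≤ ((1 - 0) / 2) ^ 2 :=
      variance_le_sq_of_bounded (Filter.Eventually.of_forall fun y =>
        ⟨val_nonneg _, val_le_one _⟩) hv.aemeasurable
    rw [Finset.sum_const, Finset.card_univ, Fintype.card_fin, nsmul_eq_mul]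
    nlinarith
  have hint : ∫ x, T x ∂ν = m * ∫ y, val (f y) ∂μ := by
    simp_rw [hTapp]
    rw [integral_finsetSum]
    · have : ∀ i : Fin m, ∫ x, val (f (x i)) ∂ν = ∫ y, val (f y) ∂μ := fun i =>
        integral_comp_eval (μ := fun _ : Fin m => μ) (f := fun y => val (f y))
          hv.aestronglyMeasurable
      simp [this]
    · intro i _
      exact (hL.comp_measurePreserving
        (measurePreserving_eval (fun _ : Fin m => μ) i)).integrable (by norm_num)
  have hc : 0 < √((m : ℝ) / 2) := Real.sqrt_pos.2 (by positivity)
  have hcheb := meas_ge_le_variance_div_sq hTm hc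
  rw [Real.sq_sqrt (by positivity), hint] at hcheb
  have hbad : ν {x | √((m : ℝ) / 2) ≤ |T x - m * ∫ y, val (f y) ∂μ|} ≤ 1 / 2 := by
    refine hcheb.trans ?_
    have : Var[T; ν] / ((m : ℝ) / 2) ≤ 1 / 2 := by
      rw [div_le_iff₀ (by positivity)]; linarith
    refine (ENNReal.ofReal_le_ofReal this).trans_eq ?_
    rw [ENNReal.ofReal_div_of_pos (by norm_num)]
    simp
  have hcov : (1 : ENNReal) ≤ ν {x | m * ∫ y, val (f y) ∂μ - √(m / 2) ≤ ∑ i, val (f (x i))}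
      + 1 / 2 := by
    calc (1 : ENNReal) = ν Set.univ := measure_univ.symm
      _ ≤ ν ({x | m * ∫ y, val (f y) ∂μ - √(m / 2) ≤ ∑ i, val (f (x i))} ∪
            {x | √((m : ℝ) / 2) ≤ |T x - m * ∫ y, val (f y) ∂μ|}) := by
          refine measure_mono fun x _ => ?_
          by_contra hx
          simp only [Set.mem_union, Set.mem_ofPred_eq, not_or, not_le, ← hTapp] at hx
          have := (abs_lt.1 hx.2).1
          linarith [hx.1]
      _ ≤ _ := (measure_union_le _ _).trans (by gcongr)
  have h12 : (1 / 2 : ENNReal) + 1 / 2 = 1 := by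
    rw [one_div]; exact ENNReal.inv_two_add_inv_two
  exact (ENNReal.add_le_add_iff_right (a := 1 / 2) (by simp)).1 (h12.trans_le hcov)

theorem measurePreserving_swapAt {X : Type*} [MeasurableSpace X] (μ : Measure X)
    [IsProbabilityMeasure μ] {m : ℕ} (σ : Fin m → Bool) :
    MeasurePreserving (swapAt σ) (Measure.pi fun _ : Fin m => μ.prod μ)
      (Measure.pi fun _ : Fin m => μ.prod μ) := by
  refine measurePreserving_pi (fun _ => μ.prod μ) (fun _ => μ.prod μ)
    (f := fun i (p : X × X) => if σ i then p else p.swap) fun i => ?_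
  cases σ i
  · simpa using! Measure.measurePreserving_swap (μ := μ) (ν := μ)
  · simpa using! MeasurePreserving.id (μ.prod μ)

/-- Symmetrization: a `[0, 1]`-valued measurable function of the double sample that is supported
on the event that some member of `F` has a large deviation has a small integral. -/
theorem lintegral_le_of_deviation {X : Type*} [MeasurableSpace X] (μ : Measure X)
    [IsProbabilityMeasure μ] {m : ℕ} (hm : 0 < m) {F : Set (X → Bool)} {N : ℝ}
    (hN : ∀ z : Fin m → X × X, ((traces F (points z)).card : ℝ) ≤ N) {u : ℝ} (hu : 0 ≤ u)
    {G : (Fin m → X × X) → ENNReal} (hG : Measurable G) (hG1 : ∀ z, G z ≤ 1)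
    (hG0 : ∀ z, (¬ ∃ f ∈ F, u ≤ ∑ i, (val (f (z i).2) - val (f (z i).1))) → G z = 0) :
    ∫⁻ z, G z ∂(Measure.pi fun _ : Fin m => μ.prod μ)
      ≤ ENNReal.ofReal (N * Real.exp (-(u ^ 2 / (2 * m)))) := by
  classical
  set ν := Measure.pi fun _ : Fin m => μ.prod μ
  set c := N * Real.exp (-(u ^ 2 / (2 * m)))
  have hinv : ∀ σ : Fin m → Bool, ∫⁻ z, G (swapAt σ z) ∂ν = ∫⁻ z, G z ∂ν := fun σ =>
    (measurePreserving_swapAt μ σ).lintegral_comp hG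
  -- The integral is invariant under each swap, so it can be averaged over all 2^m of them; the
  -- counting bound then applies at each fixed `z`.
  have hpt : ∀ z, ∑ σ : Fin m → Bool, G (swapAt σ z) ≤ 2 ^ m * ENNReal.ofReal c := by
    intro z
    have hle : ∀ σ : Fin m → Bool, G (swapAt σ z) ≤
        if ∃ f ∈ F, u ≤ ∑ i, (val (f (swapAt σ z i).2) - val (f (swapAt σ z i).1))
        then 1 else 0 := by
      intro σ
      split_ifs with h
      · exact hG1 _
      · exact (hG0 _ h).le
    refine (Finset.sum_le_sum fun σ _ => hle σ).trans ?_
    rw [Finset.sum_boole]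
    have hcard := card_swapAt_deviation_le hm z (hN z) hu
    have e : (2 : ENNReal) ^ m * ENNReal.ofReal c
        = ENNReal.ofReal (N * (2 ^ m * Real.exp (-(u ^ 2 / (2 * m))))) := by
      have : (2 : ENNReal) ^ m = ENNReal.ofReal (2 ^ m) := by
        rw [ENNReal.ofReal_pow (by norm_num)]; simp
      rw [this, ← ENNReal.ofReal_mul (by positivity)]
      congr 1
      simp only [c]
      ring
    rw [e, ← ENNReal.ofReal_natCast]
    exact ENNReal.ofReal_le_ofReal hcard
  have hsum : (2 : ENNReal) ^ m * ∫⁻ z, G z ∂ν ≤ 2 ^ m * ENNReal.ofReal c := by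
    calc (2 : ENNReal) ^ m * ∫⁻ z, G z ∂ν
        = ∑ σ : Fin m → Bool, ∫⁻ z, G (swapAt σ z) ∂ν := by
          simp [hinv]
      _ = ∫⁻ z, ∑ σ : Fin m → Bool, G (swapAt σ z) ∂ν :=
          (lintegral_finsetSum _ fun σ _ =>
            hG.comp (measurePreserving_swapAt μ σ).measurable).symm
      _ ≤ ∫⁻ _, 2 ^ m * ENNReal.ofReal c ∂ν := lintegral_mono hpt
      _ = _ := by simp
  exact (ENNReal.mul_le_mul_iff_right (by simp) (by simp)).1 hsum

/-- The Vapnik-Chervonenkis inequality for a measurably selected random member of a class. -/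
theorem measure_deviation_le {X Ω : Type*} [MeasurableSpace X] [MeasurableSpace Ω]
    [StandardBorelSpace Ω] (P : Measure Ω) [IsProbabilityMeasure P] (μ : Measure X)
    [IsProbabilityMeasure μ] {m : ℕ} (hm : 0 < m) {S : Fin m → Ω → X} (hS : ∀ i, Measurable (S i))
    (hlaw : P.map (fun ω i => S i ω) = Measure.pi fun _ : Fin m => μ)
    {e : Ω → X → Bool} (he : Measurable fun p : Ω × X => e p.1 p.2)
    {F : Set (X → Bool)} (heF : ∀ ω, e ω ∈ F) {N : ℝ}
    (hN : ∀ z : Fin m → X × X, ((traces F (points z)).card : ℝ) ≤ N) {u : ℝ} (hu : 0 ≤ u) :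
    P {ω | u + √(m / 2) ≤ m * ∫ x, val (e ω x) ∂μ - ∑ i, val (e ω (S i ω))}
      ≤ ENNReal.ofReal (2 * (N * Real.exp (-(u ^ 2 / (2 * m))))) := by
  have : Nonempty Ω := nonempty_of_isProbabilityMeasure P
  set ν := Measure.pi fun _ : Fin m => μ
  set T : Ω → Fin m → X := fun ω i => S i ω
  have hT : Measurable T := measurable_pi_lambda _ hS
  -- Disintegrating `P` along the sample makes `ω` a random draw given the sample; the ghost sample
  -- can then be drawn independently of it.
  set κ := condDistrib id T P
  have hκ : ν ⊗ₘ κ = P.map (fun ω => (T ω, ω)) := by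
    rw [← hlaw]; exact compProd_map_condDistrib aemeasurable_id
  have hev : Measurable fun p : Ω × X => val (e p.1 p.2) := measurable_val.comp he
  set dev : (Fin m → X) → Ω → (Fin m → X) → ℝ :=
    fun x ω x' => ∑ i, (val (e ω (x' i)) - val (e ω (x i)))
  have hdev : Measurable fun q : ((Fin m → X) × Ω) × (Fin m → X) => dev q.1.1 q.1.2 q.2 := by
    refine Finset.measurable_sum _ fun i _ => ?_
    exact (hev.comp (f := fun q : ((Fin m → X) × Ω) × (Fin m → X) => (q.1.2, q.2 i))
      (by fun_prop)).sub
      (hev.comp (f := fun q : ((Fin m → X) × Ω) × (Fin m → X) => (q.1.2, q.1.1 i)) (by fun_prop))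
  set E : Set (((Fin m → X) × Ω) × (Fin m → X)) := {q | u ≤ dev q.1.1 q.1.2 q.2}
  have hE : MeasurableSet E := measurableSet_le measurable_const hdev
  set E' : Set (((Fin m → X) × (Fin m → X)) × Ω) := {q | u ≤ dev q.1.1 q.2 q.1.2}
  have hE' : MeasurableSet E' := measurableSet_le measurable_const
    (hdev.comp (f := fun q : ((Fin m → X) × (Fin m → X)) × Ω => ((q.1.1, q.2), q.1.2))
      (by fun_prop))
  -- The conditional probability, given the first sample, that the selected hypothesis deviates on
  -- the pair. It is measurable even if the event that some member of `F` deviates is not.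
  set G : (Fin m → X) × (Fin m → X) → ENNReal := fun p => κ p.1 (Prod.mk p ⁻¹' E')
  have hG : Measurable G :=
    Kernel.measurable_kernel_prodMk_left (κ := κ.comap Prod.fst measurable_fst) hE'
  set bad := {ω | u + √(m / 2) ≤ m * ∫ x, val (e ω x) ∂μ - ∑ i, val (e ω (S i ω))}
  have hbad : MeasurableSet bad := by
    refine measurableSet_le measurable_const (Measurable.sub (measurable_const.mul ?_)
      (Finset.measurable_sum _ fun i _ => hev.comp (measurable_id.prodMk (hS i))))
    exact (hev.stronglyMeasurable.integral_prod_right).measurable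
  have hghost : (1 / 2 : ENNReal) * P bad ≤ ∫⁻ p, G p ∂(ν.prod ν) := by
    calc (1 / 2 : ENNReal) * P bad = ∫⁻ ω in bad, 1 / 2 ∂P := by
          rw [setLIntegral_const]
      _ ≤ ∫⁻ ω in bad, ν (Prod.mk (T ω, ω) ⁻¹' E) ∂P := by
          refine setLIntegral_mono' hbad fun ω hω => ?_
          refine (half_le_measure_sum_val_ge μ hm (f := e ω)
            (he.comp measurable_prodMk_left)).trans (measure_mono fun x' hx' => ?_)
          have h1 : u + √(m / 2) ≤ m * ∫ x, val (e ω x) ∂μ - ∑ i, val (e ω (S i ω)) := hω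
          have h2 : m * ∫ y, val (e ω y) ∂μ - √(m / 2) ≤ ∑ i, val (e ω (x' i)) := hx'
          change u ≤ ∑ i, (val (e ω (x' i)) - val (e ω (S i ω)))
          rw [Finset.sum_sub_distrib]
          linarith
      _ ≤ ∫⁻ ω, ν (Prod.mk (T ω, ω) ⁻¹' E) ∂P := setLIntegral_le_lintegral _ _
      _ = ∫⁻ q, ν (Prod.mk q ⁻¹' E) ∂(ν ⊗ₘ κ) := by
          rw [hκ, lintegral_map (measurable_measure_prodMk_left hE) (hT.prodMk measurable_id')]
      _ = ∫⁻ x, ∫⁻ ω, ν (Prod.mk (x, ω) ⁻¹' E) ∂κ x ∂ν :=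
          Measure.lintegral_compProd (measurable_measure_prodMk_left hE)
      _ = ∫⁻ x, ∫⁻ x', G (x, x') ∂ν ∂ν := by
          -- Fubini for `ω` and the ghost sample, independent once `x` is fixed.
          refine lintegral_congr fun x => ?_
          have hEx : MeasurableSet {q : Ω × (Fin m → X) | u ≤ dev x q.1 q.2} :=
            measurableSet_le measurable_const
              (hdev.comp (f := fun q : Ω × (Fin m → X) => ((x, q.1), q.2)) (by fun_prop))
          have h1 := Measure.prod_apply (μ := κ x) (ν := ν) hEx
          have h2 := Measure.prod_apply_symm (μ := κ x) (ν := ν) hEx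
          exact h1.symm.trans h2
      _ = ∫⁻ p, G p ∂(ν.prod ν) := (lintegral_prod _ hG.aemeasurable).symm
  have hmp := measurePreserving_arrowProdEquivProdArrow X X (Fin m) (fun _ => μ) (fun _ => μ)
  have hsym : ∫⁻ p, G p ∂(ν.prod ν) ≤ ENNReal.ofReal (N * Real.exp (-(u ^ 2 / (2 * m)))) := by
    rw [← hmp.lintegral_comp hG]
    refine lintegral_le_of_deviation μ hm hN hu (hG.comp hmp.measurable)
      (fun z => prob_le_one) fun z hz => ?_
    have hempty : Prod.mk (MeasurableEquiv.arrowProdEquivProdArrow X X (Fin m) z) ⁻¹' E' = ∅ := by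
      refine Set.eq_empty_of_forall_notMem fun ω hω => hz ⟨e ω, heF ω, hω⟩
    change κ _ (Prod.mk (MeasurableEquiv.arrowProdEquivProdArrow X X (Fin m) z) ⁻¹' E') = 0
    rw [hempty, measure_empty]
  have h2 : P bad = 2 * ((1 / 2 : ENNReal) * P bad) := by
    rw [← mul_assoc, one_div, ENNReal.mul_inv_cancel (by simp) (by simp), one_mul]
  rw [h2, ENNReal.ofReal_mul (by norm_num), ENNReal.ofReal_ofNat]
  gcongr
  exact hghost.trans hsym

/-! ### Domain adaptation and the ensemble -/

theorem loss_toPredictor {Z : Type*} (h : Z → Bool) (z : Z) (y : Bool) :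
    loss (toPredictor h z) y = val (xor (h z) y) := by
  unfold loss toPredictor
  cases h z <;> cases y <;> simp [val]

theorem val_xor_le (a b c : Bool) : val (xor a c) ≤ val (xor a b) + val (xor b c) := by
  cases a <;> cases b <;> cases c <;> simp [val]

theorem measurable_xor {X : Type*} [MeasurableSpace X] {f g : X → Bool} (hf : Measurable f)
    (hg : Measurable g) : Measurable fun x => xor (f x) (g x) :=
  (measurable_of_countable fun p : Bool × Bool => xor p.1 p.2).comp (hf.prodMk hg)

theorem integrable_val {X : Type*} [MeasurableSpace X] (μ : Measure X) [IsFiniteMeasure μ]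
    {f : X → Bool} (hf : Measurable f) : Integrable (fun x => val (f x)) μ :=
  Integrable.of_bound (measurable_val.comp hf).aestronglyMeasurable 1
    (Filter.Eventually.of_forall fun x => by
      rw [Real.norm_eq_abs, abs_of_nonneg (val_nonneg _)]; exact val_le_one _)

theorem integral_val {X : Type*} [MeasurableSpace X] (μ : Measure X) {f : X → Bool}
    (hf : Measurable f) : ∫ x, val (f x) ∂μ = μ.real {x | f x = true} := by
  have hs : MeasurableSet {x | f x = true} := hf (measurableSet_singleton true)
  rw [← integral_indicator_one hs]
  refine integral_congr_ae (Filter.Eventually.of_forall fun x => ?_)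
  by_cases hx : f x = true <;> simp [val, hx]

section Adaptation

variable {X Z : Type*} [MeasurableSpace X]

theorem risk_toPredictor (R : X → Z) (μ : Measure X) (c : X → Bool) (h : Z → Bool) :
    risk R ⟨μ, c⟩ (toPredictor h) = ∫ x, val (xor (h (R x)) (c x)) ∂μ := by
  simp only [risk, loss_toPredictor]

variable [MeasurableSpace Z]

/-- Integrates the triangle inequality `val_xor_le` with f as the middle term; the next lemma takes
the true label as the middle term. -/
theorem risk_le_risk_add_disagreement (μ : Measure X) [IsProbabilityMeasure μ] {c : X → Bool}
    (hc : Measurable c) {R : X → Z} (hR : Measurable R) {h f : Z → Bool} (hh : Measurable h)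
    (hf : Measurable f) :
    risk R ⟨μ, c⟩ (toPredictor h) ≤ risk R ⟨μ, c⟩ (toPredictor f)
      + (inducedImage R μ).real {z | xor (h z) (f z) = true} := by
  have hm := measurable_xor hh hf
  have I1 : Integrable (fun x => val (xor (h (R x)) (c x))) μ :=
    integrable_val _ (measurable_xor (hh.comp hR) hc)
  have I2 : Integrable (fun x => val (xor (f (R x)) (c x))) μ :=
    integrable_val _ (measurable_xor (hf.comp hR) hc)
  have I3 : Integrable (fun x => val (xor (h (R x)) (f (R x)))) μ :=
    integrable_val _ (hm.comp hR)
  rw [risk_toPredictor, risk_toPredictor, ← integral_val _ hm, inducedImage,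
    integral_map (f := fun z => val (xor (h z) (f z))) hR.aemeasurable
      (measurable_val.comp hm).aestronglyMeasurable, ← integral_add I2 I3]
  refine integral_mono I1 (I2.add I3) fun x => ?_
  have := val_xor_le (h (R x)) (f (R x)) (c x)
  change val _ ≤ val (xor (f (R x)) (c x)) + val (xor (h (R x)) (f (R x)))
  linarith

theorem disagreement_le_risk_add_risk (μ : Measure X) [IsProbabilityMeasure μ] {c : X → Bool}
    (hc : Measurable c) {R : X → Z} (hR : Measurable R) {h f : Z → Bool} (hh : Measurable h)
    (hf : Measurable f) :
    (inducedImage R μ).real {z | xor (h z) (f z) = true} ≤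
      risk R ⟨μ, c⟩ (toPredictor h) + risk R ⟨μ, c⟩ (toPredictor f) := by
  have hm := measurable_xor hh hf
  have I1 : Integrable (fun x => val (xor (h (R x)) (c x))) μ :=
    integrable_val _ (measurable_xor (hh.comp hR) hc)
  have I2 : Integrable (fun x => val (xor (f (R x)) (c x))) μ :=
    integrable_val _ (measurable_xor (hf.comp hR) hc)
  have I3 : Integrable (fun x => val (xor (h (R x)) (f (R x)))) μ :=
    integrable_val _ (hm.comp hR)
  rw [risk_toPredictor, risk_toPredictor, ← integral_val _ hm, inducedImage,
    integral_map (f := fun z => val (xor (h z) (f z))) hR.aemeasurable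
      (measurable_val.comp hm).aestronglyMeasurable, ← integral_add I1 I2]
  refine integral_mono I3 (I1.add I2) fun x => ?_
  have := val_xor_le (h (R x)) (c x) (f (R x))
  rwa [Bool.xor_comm (c x)] at this

theorem abs_sub_le_hDivergence {G : Set (Z → Bool)} {P Q : Measure Z} [IsProbabilityMeasure P]
    [IsProbabilityMeasure Q] {g : Z → Bool} (hg : g ∈ G) :
    |P.real {z | g z = true} - Q.real {z | g z = true}| ≤ hDivergence G P Q := by
  have hbdd : BddAbove {r : ℝ | ∃ g ∈ G, r = |P.real {z | g z = true} - Q.real {z | g z = true}|} := by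
    refine ⟨1, ?_⟩
    rintro r ⟨g, -, rfl⟩
    have h1 := measureReal_le_one (μ := P) (s := {z | g z = true})
    have h2 := measureReal_le_one (μ := Q) (s := {z | g z = true})
    have h3 := measureReal_nonneg (μ := P) (s := {z | g z = true})
    have h4 := measureReal_nonneg (μ := Q) (s := {z | g z = true})
    exact abs_sub_le_iff.2 ⟨by linarith, by linarith⟩
  have h := le_csSup hbdd ⟨g, hg, rfl⟩
  -- The supremum is nonnegative, so it is at most its double; the factor 2 in the divergence is
  -- slack here.
  have h0 := (abs_nonneg _).trans h
  unfold hDivergence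
  linarith

/-- The domain adaptation bound: the risk of a hypothesis on the target is at most its risk on
the source plus the divergence and the oracle term. -/
theorem risk_le_risk_add_hDivergence_add_oracle (μ ν : Measure X) [IsProbabilityMeasure μ]
    [IsProbabilityMeasure ν] {c : X → Bool} (hc : Measurable c) {R : X → Z} (hR : Measurable R)
    {H : Set (Z → Bool)} (hH : ∀ h ∈ H, Measurable h) {h : Z → Bool} (hh : h ∈ H) :
    risk R ⟨ν, c⟩ (toPredictor h) ≤ risk R ⟨μ, c⟩ (toPredictor h)
      + (hDivergence (symmDiffClass H) (inducedImage R μ) (inducedImage R ν)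
        + oracle R H ⟨μ, c⟩ ⟨ν, c⟩) := by
  have : IsProbabilityMeasure (inducedImage R μ) := Measure.isProbabilityMeasure_map hR.aemeasurable
  have : IsProbabilityMeasure (inducedImage R ν) := Measure.isProbabilityMeasure_map hR.aemeasurable
  -- Isolating the infimum allows an arbitrary competitor f; no minimizer has to exist.
  suffices H1 : risk R ⟨ν, c⟩ (toPredictor h) - risk R ⟨μ, c⟩ (toPredictor h)
      - hDivergence (symmDiffClass H) (inducedImage R μ) (inducedImage R ν)
      ≤ oracle R H ⟨μ, c⟩ ⟨ν, c⟩ by linarith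
  refine le_csInf ⟨_, h, hh, rfl⟩ ?_
  rintro r ⟨f, hf, rfl⟩
  have h1 := risk_le_risk_add_disagreement ν hc hR (hH h hh) (hH f hf)
  have h2 := disagreement_le_risk_add_risk μ hc hR (hH h hh) (hH f hf)
  have h3 := abs_sub_le_hDivergence (P := inducedImage R μ) (Q := inducedImage R ν)
    (show (fun z => xor (h z) (f z)) ∈ symmDiffClass H from ⟨h, hh, f, hf, rfl⟩)
  have h4 := (abs_le.1 h3).1
  linarith

theorem risk_ensemble_le (μ : Measure X) [IsProbabilityMeasure μ] {c : X → Bool}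
    (hc : Measurable c) {R : X → Z} (hR : Measurable R) {K : ℕ} (hK : 0 < K)
    {h : Fin K → Z → Bool} (hh : ∀ k, Measurable (h k)) :
    risk R ⟨μ, c⟩ (ensemble h) ≤ (1 / (K : ℝ)) * ∑ k, risk R ⟨μ, c⟩ (toPredictor (h k)) := by
  have hK' : (0 : ℝ) < K := by exact_mod_cast hK
  have hint : ∀ k, Integrable (fun x => loss (toPredictor (h k) (R x)) (c x)) μ := fun k => by
    simp only [loss_toPredictor]
    exact integrable_val _ (measurable_xor ((hh k).comp hR) hc)
  simp only [risk]
  rw [← integral_finsetSum _ fun k _ => hint k, ← integral_const_mul]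
  refine integral_mono_of_nonneg (Filter.Eventually.of_forall fun x => abs_nonneg _)
    ((integrable_finsetSum _ fun k _ => hint k).const_mul _)
    (Filter.Eventually.of_forall fun x => ?_)
  change |1 / (K : ℝ) * ∑ k, toPredictor (h k) (R x) - val (c x)|
    ≤ 1 / (K : ℝ) * ∑ k, |toPredictor (h k) (R x) - val (c x)|
  have e : 1 / (K : ℝ) * ∑ k, toPredictor (h k) (R x) - val (c x)
      = 1 / (K : ℝ) * ∑ k, (toPredictor (h k) (R x) - val (c x)) := by
    rw [Finset.sum_sub_distrib, Finset.sum_const, Finset.card_univ, Fintype.card_fin, nsmul_eq_mul]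
    field_simp
  rw [e, abs_mul, abs_of_nonneg (by positivity : (0 : ℝ) ≤ 1 / K)]
  exact mul_le_mul_of_nonneg_left (Finset.abs_sum_le_sum_abs _ _) (by positivity)

end Adaptation

/-! ### The bound for one user -/

/-- The error patterns of a class are at most as many as its labelings. -/
theorem card_traces_error_le {X Z ι : Type*} [Fintype ι] (H : Set (Z → Bool)) (R : X → Z)
    (c : X → Bool) (y : ι → X) :
    (traces ((fun h x => xor (h (R x)) (c x)) '' H) y).card
      ≤ (traces H fun j => R (y j)).card := by
  classical
  refine (Finset.card_le_card (t := (traces H fun j => R (y j)).image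
    fun p j => xor (p j) (c (y j))) ?_).trans Finset.card_image_le
  intro p hp
  obtain ⟨_, ⟨h, hh, rfl⟩, rfl⟩ := mem_traces.1 hp
  exact Finset.mem_image.2 ⟨_, mem_traces.2 ⟨h, hh, rfl⟩, rfl⟩

/-- The deviation that makes the symmetrized Hoeffding bound at most `t`. -/
theorem exists_deviation_eq {m : ℕ} (hm : 0 < m) {B t : ℝ} (hB : 0 ≤ B) (ht : 0 < t)
    (ht1 : t ≤ 1) : ∃ u, 0 ≤ u ∧
      u + √((m : ℝ) / 2) = m * √((4 / (m : ℝ)) * (B + Real.log (4 / t))) ∧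
      2 * (Real.exp B * Real.exp (-(u ^ 2 / (2 * m)))) ≤ t := by
  have hm' : (0 : ℝ) < m := by exact_mod_cast hm
  set A := B + Real.log (4 / t) with hA
  have hl2 : 0.6931471803 < Real.log 2 := Real.log_two_gt_d9
  have hA1 : 1 ≤ A := by
    have h4 : Real.log 4 ≤ Real.log (4 / t) :=
      Real.log_le_log (by norm_num) (by rw [le_div_iff₀ ht]; linarith)
    have : Real.log 4 = 2 * Real.log 2 := by
      rw [show (4 : ℝ) = 2 ^ 2 by norm_num, Real.log_pow]; norm_num
    linarith
  set a := √A
  have ha : a ^ 2 = A := Real.sq_sqrt (by linarith)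
  have ha1 : 1 ≤ a := Real.one_le_sqrt.2 hA1
  set s := √(m : ℝ)
  have hs : s ^ 2 = m := Real.sq_sqrt hm'.le
  have hs0 : 0 < s := Real.sqrt_pos.2 hm'
  set q := √(1 / 2 : ℝ)
  have hq : q ^ 2 = 1 / 2 := Real.sq_sqrt (by norm_num)
  have hq0 : 0 ≤ q := Real.sqrt_nonneg _
  have hq1 : q ≤ 1 := Real.sqrt_le_one.2 (by norm_num)
  have e1 : √((m : ℝ) / 2) = s * q := by
    rw [div_eq_mul_one_div, Real.sqrt_mul hm'.le]
  have e2 : m * √((4 / (m : ℝ)) * A) = s * (2 * a) := by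
    have : (4 / (m : ℝ)) * A = (2 * a / s) ^ 2 := by
      rw [div_pow, mul_pow, ha, hs]; ring
    rw [this, Real.sqrt_sq (by positivity), ← hs]
    field_simp
  -- Solves u + √(m/2) = 2√(mA); nonnegative because a ≥ 1 ≥ q, where t ≤ 1 enters through log(4/t)
  -- ≥ log 4.
  refine ⟨s * (2 * a - q), mul_nonneg hs0.le (by linarith), by rw [e1, e2]; ring, ?_⟩
  have e3 : (s * (2 * a - q)) ^ 2 / (2 * m) = (2 * a - q) ^ 2 / 2 := by
    rw [mul_pow, hs]; field_simp
  -- The right side equals A + (a - q)² - 1/4, and log 2 ≥ 1/4: the Chebyshev margin is absorbed by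
  -- the constant 4 in log(4/t).
  have h4 : A - Real.log 2 ≤ (2 * a - q) ^ 2 / 2 := by
    nlinarith [sq_nonneg (a - q)]
  rw [e3, ← Real.exp_add]
  have h5 : Real.exp (B + -((2 * a - q) ^ 2 / 2)) ≤ Real.exp (Real.log 2 - Real.log (4 / t)) :=
    Real.exp_le_exp.2 (by linarith)
  rw [Real.exp_sub, Real.exp_log (by norm_num), Real.exp_log (by positivity)] at h5
  calc _ ≤ 2 * (2 / (4 / t)) := by linarith
    _ = t := by field_simp; norm_num

/-- The generalization bound for a single user. -/
theorem measure_risk_sub_empRisk_ge_le {X Z Ω : Type*} [MeasurableSpace X] [MeasurableSpace Z]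
    [MeasurableSpace Ω] [StandardBorelSpace Ω] (P : Measure Ω) [IsProbabilityMeasure P]
    {m d : ℕ} (hm : 0 < m) (μ : Measure X) [IsProbabilityMeasure μ]
    {c : X → Bool} (hc : Measurable c) {R : X → Z} (hR : Measurable R) {H : Set (Z → Bool)}
    (hd : vcDim H = (d : ℕ∞)) (hdm : d ≤ 2 * m)
    {S : Fin m → Ω → X} (hS : ∀ i, Measurable (S i)) (hindep : iIndepFun S P)
    (hlaw : ∀ i, P.map (S i) = μ) {h : Ω → Z → Bool} (hmem : ∀ ω, h ω ∈ H)
    (hmeas : Measurable fun p : Ω × Z => h p.1 p.2) {t : ℝ} (ht : 0 < t) (ht1 : t ≤ 1) :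
    P.real {ω | empRisk R ⟨μ, c⟩ (fun i => S i ω) (toPredictor (h ω))
        + √((4 / (m : ℝ)) * (d * Real.log (2 * Real.exp 1 * m / d) + Real.log (4 / t)))
        ≤ risk R ⟨μ, c⟩ (toPredictor (h ω))} ≤ t := by
  have hm' : (0 : ℝ) < m := by exact_mod_cast hm
  set B : ℝ := d * Real.log (2 * Real.exp 1 * m / d) with hBdef
  have hB : 0 ≤ B := by
    rcases Nat.eq_zero_or_pos d with h0 | h0
    · simp [hBdef, h0]
    · have hd' : (0 : ℝ) < d := by exact_mod_cast h0
      refine mul_nonneg hd'.le (Real.log_nonneg ?_)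
      rw [le_div_iff₀ hd']
      have h1 : (d : ℝ) ≤ 2 * m := by exact_mod_cast hdm
      have h2 : (1 : ℝ) ≤ Real.exp 1 := Real.one_le_exp (by norm_num)
      nlinarith
  obtain ⟨u, hu, hueq, hut⟩ := exists_deviation_eq hm hB ht ht1
  set e : Ω → X → Bool := fun ω x => xor (h ω (R x)) (c x)
  have he : Measurable fun p : Ω × X => e p.1 p.2 :=
    measurable_xor (hmeas.comp (f := fun p : Ω × X => (p.1, R p.2)) (by fun_prop))
      (hc.comp measurable_snd)
  -- The double sample has 2m points: hence 2em/d and the condition d ≤ 2m.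
  have hN : ∀ z : Fin m → X × X,
      ((traces ((fun (h : Z → Bool) (x : X) => xor (h (R x)) (c x)) '' H) (points z)).card : ℝ) ≤ Real.exp B := by
    intro z
    have h1 := card_traces_error_le H R c (points z)
    have h2 := card_traces_le_exp hd.le (fun j => R (points z j))
      (by simpa [mul_comm m] using hdm)
    refine le_trans (by exact_mod_cast h1) (h2.trans_eq ?_)
    rw [Fintype.card_prod, Fintype.card_fin, Fintype.card_bool, hBdef]
    push_cast
    ring_nf
  have hpi : P.map (fun ω i => S i ω) = Measure.pi fun _ : Fin m => μ := by
    rw [(iIndepFun_iff_map_fun_eq_pi_map fun i => (hS i).aemeasurable).1 hindep]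
    simp only [hlaw]
  have heF : ∀ ω, e ω ∈ (fun (h : Z → Bool) (x : X) => xor (h (R x)) (c x)) '' H :=
    fun ω => ⟨h ω, hmem ω, rfl⟩
  have key := measure_deviation_le P μ hm hS hpi he heF hN hu
  refine ENNReal.toReal_le_of_le_ofReal ht.le
    (le_trans (measure_mono ?_) (key.trans (ENNReal.ofReal_le_ofReal hut)))
  intro ω hω
  have hω' : empRisk R ⟨μ, c⟩ (fun i => S i ω) (toPredictor (h ω))
      + √((4 / (m : ℝ)) * (B + Real.log (4 / t))) ≤ risk R ⟨μ, c⟩ (toPredictor (h ω)) := hω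
  rw [risk_toPredictor] at hω'
  simp only [empRisk, loss_toPredictor] at hω'
  have h1 := mul_le_mul_of_nonneg_left hω' hm'.le
  rw [mul_add, ← mul_assoc, mul_one_div_cancel hm'.ne', one_mul, ← hueq] at h1
  change u + √((m : ℝ) / 2) ≤ m * ∫ x, val (xor (h ω (R x)) (c x)) ∂μ
    - ∑ i, val (xor (h ω (R (S i ω))) (c (S i ω)))
  linarith

end FedLearn

/-! ### Union bound over the users -/

theorem theorem1
    {X Z Ω : Type*} [MeasurableSpace X] [MeasurableSpace Z]
    -- the probability space that carries the data and the training randomness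
    [MeasurableSpace Ω] [StandardBorelSpace Ω] (P : Measure Ω) [IsProbabilityMeasure P]
    -- `K` users with `m` samples each
    (K m d : ℕ) (hK : 0 < K) (hm : 0 < m)
    -- local distributions, global distribution, common labeling, feature map
    (Dloc : Fin K → Measure X) [∀ k, IsProbabilityMeasure (Dloc k)]
    (D : Measure X) [IsProbabilityMeasure D]
    (c : X → Bool) (hc : Measurable c)
    (R : X → Z) (hR : Measurable R)
    -- the hypothesis class, of VC dimension `d`
    (H : Set (Z → Bool)) (hH : ∀ h ∈ H, Measurable h)
    (hd : FedLearn.vcDim H = (d : ℕ∞)) (hdm : d ≤ 2 * m)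
    -- the samples of user `k` are i.i.d. with law `Dloc k`
    (S : Fin K → Fin m → Ω → X) (hS : ∀ k i, Measurable (S k i))
    (hindep : ∀ k, iIndepFun (fun i => S k i) P)
    (hlaw : ∀ k i, P.map (S k i) = Dloc k)
    -- the learned (hence random) hypotheses
    (h : Fin K → Ω → Z → Bool) (hmem : ∀ k ω, h k ω ∈ H)
    (hmeas : ∀ k, Measurable (fun p : Ω × Z => h k p.1 p.2))
    (δ : ℝ) (hδ : 0 < δ) :
    1 - δ ≤ P.real {ω |
      FedLearn.risk R ⟨D, c⟩ (FedLearn.ensemble (fun k => h k ω)) ≤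
        (1 / (K : ℝ)) * ∑ k, FedLearn.empRisk R ⟨Dloc k, c⟩ (fun i => S k i ω)
            (FedLearn.toPredictor (h k ω))
        + (1 / (K : ℝ)) * ∑ k,
            (FedLearn.hDivergence (FedLearn.symmDiffClass H)
                (FedLearn.inducedImage R (Dloc k)) (FedLearn.inducedImage R D)
              + FedLearn.oracle R H ⟨Dloc k, c⟩ ⟨D, c⟩)
        + Real.sqrt ((4 / (m : ℝ)) *
            ((d : ℝ) * Real.log (2 * Real.exp 1 * m / d) + Real.log (4 * K / δ)))} := by
  have hK' : (0 : ℝ) < K := by exact_mod_cast hK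
  rcases lt_or_ge 1 δ with h1 | h1
  · exact le_trans (by linarith) measureReal_nonneg
  set t : ℝ := δ / K with ht
  have ht0 : 0 < t := by positivity
  have ht1 : t ≤ 1 := by
    have : (1 : ℝ) ≤ K := by exact_mod_cast hK
    rw [ht, div_le_one hK']; linarith
  have e4 : 4 * (K : ℝ) / δ = 4 / t := by rw [ht]; field_simp
  rw [e4]
  set ε := Real.sqrt ((4 / (m : ℝ)) *
    ((d : ℝ) * Real.log (2 * Real.exp 1 * m / d) + Real.log (4 / t)))
  set bad : Fin K → Set Ω := fun k =>
    {ω | FedLearn.empRisk R ⟨Dloc k, c⟩ (fun i => S k i ω) (FedLearn.toPredictor (h k ω)) + ε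
      ≤ FedLearn.risk R ⟨Dloc k, c⟩ (FedLearn.toPredictor (h k ω))}
  have hbad : ∀ k, P.real (bad k) ≤ t := fun k =>
    FedLearn.measure_risk_sub_empRisk_ge_le P hm (Dloc k) hc hR hd hdm (hS k) (hindep k) (hlaw k)
      (hmem k) (hmeas k) ht0 ht1
  have hU : P.real (⋃ k, bad k) ≤ δ := by
    refine (measureReal_iUnion_fintype_le bad).trans
      ((Finset.sum_le_sum fun k _ => hbad k).trans_eq ?_)
    rw [Finset.sum_const, Finset.card_univ, Fintype.card_fin, nsmul_eq_mul, ht]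
    field_simp
  -- Subadditivity alone suffices, so measurability of the bad events is not needed.
  have hcompl : 1 ≤ P.real (⋃ k, bad k) + P.real (⋃ k, bad k)ᶜ := by
    have h2 := measureReal_union_le (μ := P) (⋃ k, bad k) (⋃ k, bad k)ᶜ
    rwa [Set.union_compl_self, probReal_univ] at h2
  refine le_trans (by linarith : 1 - δ ≤ P.real (⋃ k, bad k)ᶜ)
    (measureReal_mono fun ω hω => ?_)
  have hgood : ∀ k, FedLearn.risk R ⟨Dloc k, c⟩ (FedLearn.toPredictor (h k ω)) ≤
      FedLearn.empRisk R ⟨Dloc k, c⟩ (fun i => S k i ω) (FedLearn.toPredictor (h k ω)) + ε := by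
    intro k
    by_contra hk
    exact hω (Set.mem_iUnion.2 ⟨k, (not_le.1 hk).le⟩)
  have hstep : ∀ k, FedLearn.risk R ⟨D, c⟩ (FedLearn.toPredictor (h k ω)) ≤
      FedLearn.empRisk R ⟨Dloc k, c⟩ (fun i => S k i ω) (FedLearn.toPredictor (h k ω))
      + (FedLearn.hDivergence (FedLearn.symmDiffClass H)
          (FedLearn.inducedImage R (Dloc k)) (FedLearn.inducedImage R D)
        + FedLearn.oracle R H ⟨Dloc k, c⟩ ⟨D, c⟩) + ε := fun k => by
    have h2 := FedLearn.risk_le_risk_add_hDivergence_add_oracle (Dloc k) D hc hR hH (hmem k ω)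
    linarith [hgood k]
  refine (FedLearn.risk_ensemble_le D hc hR hK fun k => hH _ (hmem k ω)).trans
    ((mul_le_mul_of_nonneg_left (Finset.sum_le_sum fun k _ => hstep k)
      (by positivity)).trans_eq ?_)
  rw [Finset.sum_add_distrib, Finset.sum_add_distrib, Finset.sum_const, Finset.card_univ,
    Fintype.card_fin, nsmul_eq_mul, mul_add, mul_add, ← mul_assoc, one_div_mul_cancel hK'.ne',
    one_mul]
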